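/- Let $k>2$ be an integer, let $0=\lambda_0<\lambda_1<\dots<\lambda_k=\lambda$ be real numbers, and let $\pi$ be a permutation of $\{1,\dots,k\}$. Let $T\colon[0,\lambda]\to[0,\lambda]$ be the associated $k$-interval exchange transformation: for $1\le i\le k$ and $x\in[\lambda_{i-1},\lambda_i)$, $$T(x)=x-\lambda_{i-1}+\sum_{j\,:\,\pi(j)<\pi(i)}(\lambda_j-\lambda_{j-1}),$$ so that the intervals $[\lambda_{i-1},\lambda_i)$ are rearranged by translations in the order given by $\pi$ (the value of $T$ at the right endpoint $\lambda$ is arbitrary). Suppose that $T$ is minimal, i.e. for every $x\in[0,\lambda]$ the full orbit $\{y\in[0,\lambda] : T^m x=T^n y \text{ for some integers } m,n\ge 0\}$ is dense in $[0,\lambda]$; for $x\in[0,\lambda)$ this is, up to possibly the point $\lambda$, the two-sided orbit $\{T^n x : n\in\mathbb{Z}\}$ of the bijection $T|_{[0,\lambda)}$. Call a Borel probability measure $\mu$ on $[0,\lambda]$ generic if $T$ preserves $\mu$ and there is a point $x\in[0,\lambda]$ such that $$\lim_{N\to\infty}\frac1N\sum_{n=0}^{N-1}f(T^n x)=\int f\,d\mu$$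 for every continuous function $f\colon[0,\lambda]\to\mathbb{R}$. Then $T$ has at most $k-2$ generic measures. -/

import Mathlib

open MeasureTheory Filter Topology

/-- `T` is the `k`-interval exchange transformation of `[0, lam k]` with partition points
`0 = lam 0 < lam 1 < ⋯ < lam k` and permutation `π`: it translates the `i`-th interval
`[lam i, lam (i + 1))` so that the intervals appear, from left to right, in the order prescribed
by `π` (the `i`-th interval gets position `π i`, so the left endpoint of its image is the total
length of the intervals with smaller position).
The half-open intervals do not contain the right endpoint `lam k`;
the value of `T` at that single point is left arbitrary. -/
structure IsIntervalExchange (k : ℕ) (π : Equiv.Perm (Fin k)) (lam : Fin (k + 1) → ℝ)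
    (T : Set.Icc (0 : ℝ) (lam (Fin.last k)) → Set.Icc (0 : ℝ) (lam (Fin.last k))) : Prop where
  lam_zero : lam 0 = 0
  lam_strictMono : StrictMono lam
  map_eq : ∀ (i : Fin k) (x : Set.Icc (0 : ℝ) (lam (Fin.last k))),
    (x : ℝ) ∈ Set.Ico (lam i.castSucc) (lam i.succ) →
      (T x : ℝ) = ((x : ℝ) - lam i.castSucc) +
        ∑ j : Fin k with π j < π i, (lam j.succ - lam j.castSucc)

/-- The full (two-sided) orbit of `x` under `T`: all `y` such that some forward iterate of `y`
equals some forward iterate of `x`. For bijective `T` this is `{T ^ n x : n ∈ ℤ}`. -/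
def fullOrbit {X : Type*} (T : X → X) (x : X) : Set X :=
  {y | ∃ m n : ℕ, T^[m] x = T^[n] y}

/-- `T` is minimal: the full orbit of every point is dense. -/
def IsMinimalMap {X : Type*} [TopologicalSpace X] (T : X → X) : Prop :=
  ∀ x : X, Dense (fullOrbit T x)

/-- `x` is a generic point for `μ`: for every continuous `f : X → ℝ`, the averages
`(1 / N) * ∑ n < N, f (T^n x)` converge to `∫ f dμ`. -/
def IsGenericPointFor {X : Type*} [TopologicalSpace X] [MeasurableSpace X]
    (T : X → X) (μ : Measure X) (x : X) : Prop :=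
  ∀ f : C(X, ℝ), Tendsto (fun N : ℕ => birkhoffAverage ℝ T f N x) atTop (𝓝 (∫ y, f y ∂μ))

/-- `μ` is a generic measure for `T`: a `T`-invariant Borel probability measure that has a
generic point. -/
structure IsGenericMeasure {X : Type*} [TopologicalSpace X] [MeasurableSpace X]
    (T : X → X) (μ : Measure X) : Prop where
  isProbabilityMeasure : IsProbabilityMeasure μ
  measurePreserving : MeasurePreserving T μ μ
  exists_genericPoint : ∃ x : X, IsGenericPointFor T μ x

/-! Code an orbit by the pieces it visits between the `k - 1` interior end points. Points sharing a
code word of length `n` form an interval (a cylinder) translated rigidly by `T^n`. A word with two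
continuations is right special; its cylinder contains a point sent by `T^n` to an end point, so
there are at most `r = k - 1` right special words of each length. By minimality no itinerary is
periodic, so every orbit meets a right special word within `r * n` steps
(`exists_isRightSpecial_iterate`).

Suppose there were `r` generic measures, with generic points `x i`. Points with equal long words
stay close, so windows of length `n` starting before time `A * n` have Birkhoff averages too far
apart for two different orbits to share a word, once `n` is large (`eventually_not_sameItinerary`).
Hence the `r` orbits use up all right special words, one each, and each such word is cut only once.
If one orbit left its word on both sides, the words it sees would form a forward invariant family,
which by Poincaré recurrence and minimality contains every word, including those of another orbit
(`exists_sameItinerary_mem`). So each orbit always continues in the same way and is periodic at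
scale `n` (`exists_period_of_disjoint`). Periods at consecutive scales overlap enough to give an
eventually periodic itinerary (`exists_eventually_periodic`), contradicting minimality. -/

/-- The set of points of `D` that are at most `x`. Two points lie in the same piece of the
partition of the line cut by `D` exactly when their codes agree. -/
noncomputable def cutCode (D : Finset ℝ) (x : ℝ) : Finset ℝ := D.filter (fun d => d ≤ x)

theorem cutCode_eq_iff {D : Finset ℝ} {x y : ℝ} :
    cutCode D x = cutCode D y ↔ ∀ d ∈ D, d ≤ x ↔ d ≤ y := by
  simp [cutCode, Finset.ext_iff]

/-- `T` is an injective map of `[0, L)` which is a translation on each piece cut by `D`. -/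
structure IsPiecewiseTranslation {L : ℝ} (D : Finset ℝ) (T : Set.Ico 0 L → Set.Ico 0 L) :
    Prop where
  injective : Function.Injective T
  sub_eq : ∀ x y : Set.Ico 0 L, cutCode D x = cutCode D y → (T y : ℝ) - T x = y - x

/-- The itineraries of `x` and `y` agree up to time `n`. -/
def SameItinerary {L : ℝ} (D : Finset ℝ) (T : Set.Ico 0 L → Set.Ico 0 L) (n : ℕ)
    (x y : Set.Ico 0 L) : Prop :=
  ∀ s < n, cutCode D (T^[s] x) = cutCode D (T^[s] y)

/-- The itinerary of `y` up to time `n` does not determine its itinerary up to time `n + 1`. -/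
def IsRightSpecial {L : ℝ} (D : Finset ℝ) (T : Set.Ico 0 L → Set.Ico 0 L) (n : ℕ)
    (y : Set.Ico 0 L) : Prop :=
  ∃ z, SameItinerary D T n y z ∧ ¬ SameItinerary D T (n + 1) y z

/-- The full orbit of every point meets every open subinterval. -/
def OrbitsMeetIntervals {L : ℝ} (T : Set.Ico 0 L → Set.Ico 0 L) : Prop :=
  ∀ (x : Set.Ico 0 L) (a b : ℝ), 0 ≤ a → a < b → b ≤ L →
    ∃ y : Set.Ico 0 L, a < y ∧ (y : ℝ) < b ∧ ∃ m n : ℕ, T^[m] x = T^[n] y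

/-! ### Cylinders, right special words and aperiodicity -/

section Itinerary

variable {L : ℝ} {D : Finset ℝ} {T : Set.Ico 0 L → Set.Ico 0 L} {n : ℕ} {x y z : Set.Ico 0 L}

namespace SameItinerary

theorem refl (n : ℕ) (x : Set.Ico 0 L) : SameItinerary D T n x x := fun _ _ => rfl

theorem symm (h : SameItinerary D T n x y) : SameItinerary D T n y x :=
  fun s hs => (h s hs).symm

theorem trans (h : SameItinerary D T n x y) (h' : SameItinerary D T n y z) :
    SameItinerary D T n x z :=
  fun s hs => (h s hs).trans (h' s hs)

theorem mono {m : ℕ} (h : SameItinerary D T n x y) (hm : m ≤ n) : SameItinerary D T m x y :=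
  fun s hs => h s (hs.trans_le hm)

theorem succ_iff : SameItinerary D T (n + 1) x y ↔
    SameItinerary D T n x y ∧ cutCode D (T^[n] x) = cutCode D (T^[n] y) := by
  constructor
  · exact fun h => ⟨h.mono n.le_succ, h n n.lt_succ_self⟩
  · rintro ⟨h, h'⟩ s hs
    rcases Nat.lt_succ_iff_lt_or_eq.1 hs with hs | rfl
    exacts [h s hs, h']

theorem iterate {q : ℕ} (h : SameItinerary D T (n + q) x y) :
    SameItinerary D T n (T^[q] x) (T^[q] y) := by
  intro s hs
  rw [← Function.iterate_add_apply, ← Function.iterate_add_apply]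
  exact h _ (by omega)

theorem iterate_sub (hT : IsPiecewiseTranslation D T) (h : SameItinerary D T n x y) :
    (T^[n] y : ℝ) - T^[n] x = y - x := by
  induction n with
  | zero => rfl
  | succ n ih =>
    rw [Function.iterate_succ_apply', Function.iterate_succ_apply',
      hT.sub_eq _ _ (h n n.lt_succ_self)]
    exact ih (h.mono n.le_succ)

theorem iterate_sub_of_le (hT : IsPiecewiseTranslation D T) (h : SameItinerary D T n x y)
    {s : ℕ} (hs : s ≤ n) : (T^[s] y : ℝ) - T^[s] x = y - x :=
  (h.mono hs).iterate_sub hT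

/-- Cylinders are intervals: the iterates translate `x`, `y` and `z` by the same amount as long as
their codes agree, so `z` stays between the other two and no cut can separate it. -/
theorem of_mem_Icc (hT : IsPiecewiseTranslation D T) (h : SameItinerary D T n x y)
    (hxz : x ≤ z) (hzy : z ≤ y) : SameItinerary D T n x z := by
  induction n with
  | zero => exact fun s hs => absurd hs (Nat.not_lt_zero s)
  | succ n ih =>
    have hn := h.mono n.le_succ
    have hz := ih hn
    refine succ_iff.2 ⟨hz, cutCode_eq_iff.2 fun d hd => ?_⟩
    have h1 := hn.iterate_sub hT
    have h2 := hz.iterate_sub hT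
    have h3 := cutCode_eq_iff.1 (h n n.lt_succ_self) d hd
    have hxz' : (x : ℝ) ≤ z := hxz
    have hzy' : (z : ℝ) ≤ y := hzy
    exact ⟨fun h => by linarith, fun h => h3.2 (by linarith)⟩

/-- If the itineraries of `x < y` separate at time `n`, then a point in between is mapped to a
cut point by the `n`-th iterate. -/
theorem exists_cut (hT : IsPiecewiseTranslation D T) (h : SameItinerary D T n x y)
    (h' : ¬ SameItinerary D T (n + 1) x y) (hxy : x < y) :
    ∃ u : Set.Ico 0 L, x < u ∧ u ≤ y ∧ (T^[n] u : ℝ) ∈ D ∧ SameItinerary D T n x u := by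
  have hc : ¬ ∀ d ∈ D, d ≤ (T^[n] x : ℝ) ↔ d ≤ (T^[n] y : ℝ) := fun hc =>
    h' (succ_iff.2 ⟨h, cutCode_eq_iff.2 hc⟩)
  push Not at hc
  obtain ⟨d, hd, hdc⟩ := hc
  have hxy' : (x : ℝ) < y := hxy
  have h1 := h.iterate_sub hT
  have hd2 : (T^[n] x : ℝ) < d ∧ d ≤ (T^[n] y : ℝ) := by
    rcases hdc with hdc | hdc
    · exfalso; linarith
    · exact hdc
  have hx := x.2.1
  have hy := y.2.2
  let u : Set.Ico 0 L := ⟨x + (d - T^[n] x), by linarith, by linarith⟩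
  have hxu : x < u := by
    change (x : ℝ) < x + (d - T^[n] x); linarith
  have huy : u ≤ y := by
    change (x : ℝ) + (d - T^[n] x) ≤ y; linarith
  have hu := h.of_mem_Icc hT hxu.le huy
  refine ⟨u, hxu, huy, ?_, hu⟩
  have h2 := hu.iterate_sub hT
  have h3 : (u : ℝ) = x + (d - T^[n] x) := rfl
  have : (T^[n] u : ℝ) = d := by linarith
  rwa [this]

end SameItinerary

theorem IsRightSpecial.of_sameItinerary (h : IsRightSpecial D T n x)
    (hxy : SameItinerary D T n x y) : IsRightSpecial D T n y := by
  obtain ⟨z, hz, hz'⟩ := h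
  by_cases hy : SameItinerary D T (n + 1) x y
  · exact ⟨z, hxy.symm.trans hz, fun h => hz' (hy.trans h)⟩
  · exact ⟨x, hxy.symm, fun h => hy h.symm⟩

/-- As `T^[n]` is injective, this allows at most one right special cylinder of order `n` per cut
point. -/
theorem IsRightSpecial.exists_cut (hT : IsPiecewiseTranslation D T) (h : IsRightSpecial D T n x) :
    ∃ u : Set.Ico 0 L, (T^[n] u : ℝ) ∈ D ∧ SameItinerary D T n x u := by
  obtain ⟨z, hz, hz'⟩ := h
  rcases lt_trichotomy x z with hxz | rfl | hxz
  · obtain ⟨u, -, -, hu, hu'⟩ := hz.exists_cut hT hz' hxz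
    exact ⟨u, hu, hu'⟩
  · exact absurd (SameItinerary.refl _ _) hz'
  · obtain ⟨u, -, -, hu, hu'⟩ := hz.symm.exists_cut hT (fun h => hz' h.symm) hxz
    exact ⟨u, hu, hz.trans hu'⟩

theorem SameItinerary.succ_of_not_isRightSpecial (h : SameItinerary D T n x y)
    (hx : ¬ IsRightSpecial D T n x) : SameItinerary D T (n + 1) x y := by
  by_contra h'
  exact hx ⟨y, h, h'⟩

open Classical in
/-- The number of preimages, of order less than `n`, of cut points that are at most `y`. -/
noncomputable def cutCount (D : Finset ℝ) (T : Set.Ico 0 L → Set.Ico 0 L) (n : ℕ)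
    (y : Set.Ico 0 L) : ℕ :=
  ∑ s ∈ Finset.range n, (D.filter (fun d => ∃ u ≤ y, (T^[s] u : ℝ) = d)).card

theorem cutCount_le : cutCount D T n y ≤ D.card * n := by
  classical
  unfold cutCount
  calc _ ≤ ∑ s ∈ Finset.range n, D.card :=
        Finset.sum_le_sum fun s _ => Finset.card_le_card (Finset.filter_subset _ _)
    _ = D.card * n := by simp [mul_comm]

/-- The cut that first separates `x` from `y` has a preimage in `(x, y]`, counted for `y` only. Thus
`cutCount` labels the cylinders of order `n`, and there are at most `D.card * n + 1` of them. -/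
theorem cutCount_lt (hT : IsPiecewiseTranslation D T) (hxy : x < y)
    (h : ¬ SameItinerary D T n x y) : cutCount D T n x < cutCount D T n y := by
  classical
  induction n with
  | zero => exact absurd (fun s hs => absurd hs (Nat.not_lt_zero s)) h
  | succ n ih =>
    have hsub : D.filter (fun d => ∃ u ≤ x, (T^[n] u : ℝ) = d) ⊆
        D.filter (fun d => ∃ u ≤ y, (T^[n] u : ℝ) = d) :=
      Finset.monotone_filter_right _ fun d _ ⟨u, hu, hd⟩ => ⟨u, hu.trans hxy.le, hd⟩
    have hle : cutCount D T n x ≤ cutCount D T n y :=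
      Finset.sum_le_sum fun s _ => Finset.card_le_card <|
        Finset.monotone_filter_right _ fun d _ ⟨u, hu, hd⟩ => ⟨u, hu.trans hxy.le, hd⟩
    simp only [cutCount, Finset.sum_range_succ] at ih hle ⊢
    by_cases hn : SameItinerary D T n x y
    · obtain ⟨u, hxu, huy, hu, -⟩ := hn.exists_cut hT h hxy
      refine add_lt_add_of_le_of_lt hle (Finset.card_lt_card ⟨hsub, fun hs => ?_⟩)
      have := hs (Finset.mem_filter.2 ⟨hu, u, huy, rfl⟩)
      obtain ⟨-, v, hv, hvu⟩ := Finset.mem_filter.1 this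
      have := hT.injective.iterate n (Subtype.ext hvu)
      subst this
      exact absurd hv (not_le.2 hxu)
    · exact add_lt_add_of_lt_of_le (ih hn) (Finset.card_le_card hsub)

theorem SameItinerary.of_cutCount_eq (hT : IsPiecewiseTranslation D T)
    (h : cutCount D T n x = cutCount D T n y) : SameItinerary D T n x y := by
  by_contra hn
  rcases lt_trichotomy x y with hxy | rfl | hxy
  · exact (cutCount_lt hT hxy hn).ne h
  · exact hn (refl _ _)
  · exact (cutCount_lt hT hxy fun h => hn h.symm).ne h.symm

/-- No point of a minimal piecewise translation is periodic. -/
theorem iterate_ne_self (hT : IsPiecewiseTranslation D T) (hmin : OrbitsMeetIntervals T)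
    {p : ℕ} (hp : 0 < p) (x : Set.Ico 0 L) : T^[p] x ≠ x := by
  intro hper
  have hL : 0 < L := x.2.1.trans_lt x.2.2
  set F : Finset ℝ := (Finset.range p).image fun s => (T^[s] x : ℝ) with hF
  obtain ⟨a, b, ha, hab, hb, hdis⟩ : ∃ a b : ℝ, 0 ≤ a ∧ a < b ∧ b ≤ L ∧
      ∀ y, a < y → y < b → y ∉ F := by
    obtain ⟨c, hc, hcF⟩ := ((Set.Ioo_infinite hL).sdiff F.finite_toSet).nonempty
    have hopen : IsOpen (Set.Ioo 0 L \ (F : Set ℝ)) := isOpen_Ioo.sdiff F.finite_toSet.isClosed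
    obtain ⟨ε, hε, hball⟩ := Metric.isOpen_iff.1 hopen c ⟨hc, hcF⟩
    refine ⟨c, min (c + ε) L, hc.1.le, lt_min (by linarith) hc.2, min_le_right _ _, ?_⟩
    intro y hy hy' hyF
    refine (hball (?_ : y ∈ Metric.ball c ε)).2 hyF
    rw [Metric.mem_ball, Real.dist_eq, abs_lt]
    have := hy'.trans_le (min_le_left _ _)
    constructor <;> linarith
  obtain ⟨y, hay, hyb, m, n, hmn⟩ := hmin x a b ha hab hb
  refine hdis y hay hyb (Finset.mem_image.2 ?_)
  have hpn : ∀ j, T^[p * j] x = x := fun j => by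
    rw [Function.iterate_mul]; exact Function.iterate_fixed hper j
  -- Adding `n` full periods makes the exponent at least `n`, so `y` itself lies on the finite
  -- forward orbit of `x`.
  have hle : n ≤ m + p * n := le_add_left (Nat.le_mul_of_pos_left n hp)
  have hy : T^[m + p * n - n] x = y := by
    apply hT.injective.iterate n
    rw [← Function.iterate_add_apply, Nat.add_sub_cancel' hle, Function.iterate_add_apply, hpn, hmn]
  refine ⟨(m + p * n - n) % p, Finset.mem_range.2 (Nat.mod_lt _ hp), ?_⟩
  conv_rhs => rw [← hy, ← Nat.mod_add_div (m + p * n - n) p, Function.iterate_add_apply, hpn]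

/-- No itinerary of a minimal piecewise translation is periodic. -/
theorem not_forall_sameItinerary_iterate (hT : IsPiecewiseTranslation D T)
    (hmin : OrbitsMeetIntervals T) {p : ℕ} (hp : 0 < p) (x : Set.Ico 0 L) :
    ¬ ∀ n, SameItinerary D T n x (T^[p] x) := by
  intro h
  apply iterate_ne_self hT hmin hp x
  -- A periodic itinerary repeats the same displacement over each period; boundedness of the orbit
  -- forces it to be zero.
  have key : ∀ j : ℕ, (T^[p * j] x : ℝ) = x + j * (T^[p] x - x) := by
    intro j
    induction j with
    | zero => simp
    | succ j ih =>
      have h1 := (h (p * j)).iterate_sub hT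
      rw [← Function.iterate_add_apply] at h1
      push_cast
      rw [Nat.mul_succ]
      linarith
  have hc : (T^[p] x : ℝ) - x = 0 := by
    by_contra hc
    obtain ⟨j, hj⟩ := exists_nat_gt (L / |(T^[p] x : ℝ) - x|)
    rw [div_lt_iff₀ (abs_pos.2 hc)] at hj
    have h1 := key j
    have h2 : |(j : ℝ) * (T^[p] x - x)| < L := by
      rw [abs_lt]
      have := (T^[p * j] x).2.1
      have := (T^[p * j] x).2.2
      have := x.2.1
      have := x.2.2
      constructor <;> linarith
    rw [abs_mul, Nat.abs_cast] at h2
    linarith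
  exact Subtype.ext (by linarith)

theorem not_forall_cutCode_iterate_add (hT : IsPiecewiseTranslation D T)
    (hmin : OrbitsMeetIntervals T) {p : ℕ} (hp : 0 < p) (x : Set.Ico 0 L) (s : ℕ) :
    ¬ ∀ v ≥ s, cutCode D (T^[v + p] x) = cutCode D (T^[v] x) := by
  intro h
  refine not_forall_sameItinerary_iterate hT hmin hp (T^[s] x) fun n t _ => ?_
  rw [← Function.iterate_add_apply, ← Function.iterate_add_apply, ← Function.iterate_add_apply,
    ← h (t + s) (by omega)]
  congr 3
  omega

/-- Right special points are visited with bounded gaps. -/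
theorem exists_isRightSpecial_iterate (hT : IsPiecewiseTranslation D T)
    (hmin : OrbitsMeetIntervals T) (hn : 0 < n) (y : Set.Ico 0 L) :
    ∃ t ≤ D.card * n, IsRightSpecial D T n (T^[t] y) := by
  by_contra! hns
  -- There are `D.card * n + 2` times and at most `D.card * n + 1` cylinders, so one cylinder is
  -- visited twice.
  obtain ⟨s, t, hst, ht, hc⟩ : ∃ s t, s < t ∧ t ≤ D.card * n + 1 ∧
      cutCount D T n (T^[s] y) = cutCount D T n (T^[t] y) := by
    obtain ⟨a, ha, b, hb, hab, h⟩ := Finset.exists_ne_map_eq_of_card_lt_of_maps_to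
      (s := Finset.range (D.card * n + 2)) (t := Finset.range (D.card * n + 1))
      (f := fun t => cutCount D T n (T^[t] y)) (by simp)
      (fun t _ => by simpa [Nat.lt_succ_iff] using cutCount_le)
    simp only [Finset.mem_range] at ha hb
    rcases lt_or_gt_of_ne hab with hab | hab
    · exact ⟨a, b, hab, by omega, h⟩
    · exact ⟨b, a, hab, by omega, h.symm⟩
  obtain ⟨p, rfl⟩ := Nat.exists_eq_add_of_lt hst
  -- Without right special visits each word determines the next one, so the repetition propagates
  -- forever; words after the first period are non-special because they copy earlier ones.
  have key : ∀ v, ¬ IsRightSpecial D T n (T^[s + v] y) ∧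
      SameItinerary D T n (T^[s + v] y) (T^[s + v + (p + 1)] y) := by
    intro v
    induction v using Nat.strong_induction_on with
    | _ v ih =>
      constructor
      · by_cases hv : v ≤ p
        · exact hns _ (by omega)
        · obtain ⟨w, rfl⟩ := Nat.exists_eq_add_of_lt (not_le.1 hv)
          intro hsp
          obtain ⟨h1, h2⟩ := ih w (by omega)
          apply h1
          refine hsp.of_sameItinerary ?_
          have : s + (p + w + 1) = s + w + (p + 1) := by omega
          rw [this]
          exact h2.symm
      · cases v with
        | zero => exact SameItinerary.of_cutCount_eq hT hc
        | succ v =>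
          obtain ⟨h1, h2⟩ := ih v (by omega)
          have h3 := (h2.succ_of_not_isRightSpecial h1).iterate
          rw [← Function.iterate_add_apply, ← Function.iterate_add_apply] at h3
          rwa [show 1 + (s + v) = s + (v + 1) by omega,
            show 1 + (s + v + (p + 1)) = s + (v + 1) + (p + 1) by omega] at h3
  refine not_forall_cutCode_iterate_add hT hmin (Nat.succ_pos p) y s fun v hv => ?_
  have := (key (v - s)).2 0 hn
  rw [Nat.add_sub_cancel' hv] at this
  exact this.symm

/-- Points with the same itinerary up to a large time are close. -/
theorem exists_forall_sameItinerary_abs_sub_lt (hT : IsPiecewiseTranslation D T)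
    (hmin : OrbitsMeetIntervals T) {ε : ℝ} (hε : 0 < ε) :
    ∃ n₀, ∀ n ≥ n₀, ∀ x y : Set.Ico 0 L, SameItinerary D T n x y → |(x : ℝ) - y| < ε := by
  by_contra! hcon
  have hfar : ∀ n, ∃ x y : Set.Ico 0 L, SameItinerary D T n x y ∧ (x : ℝ) + ε ≤ y := by
    intro n
    obtain ⟨m, hm, x, y, hxy, hd⟩ := hcon n
    rcases le_abs.1 hd with hd | hd
    · exact ⟨y, x, (hxy.mono hm).symm, by linarith⟩
    · exact ⟨x, y, hxy.mono hm, by linarith⟩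
  choose a b hab hlen using hfar
  -- a fixed grid interval is contained in infinitely many of the intervals `[a n, b n]`
  let g : ℕ → ℕ := fun n => ⌈(a n : ℝ) / (ε / 2)⌉₊
  have hg1 : ∀ n, (a n : ℝ) ≤ g n * (ε / 2) := fun n => by
    rw [← div_le_iff₀ (by linarith)]; exact Nat.le_ceil _
  have hg2 : ∀ n, (g n : ℝ) * (ε / 2) < a n + ε / 2 := fun n => by
    have := Nat.ceil_lt_add_one (div_nonneg (a n).2.1 (by linarith : (0 : ℝ) ≤ ε / 2))
    have h2 : (g n : ℝ) * (ε / 2) < ((a n : ℝ) / (ε / 2) + 1) * (ε / 2) :=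
      mul_lt_mul_of_pos_right this (by linarith)
    rw [add_mul, div_mul_cancel₀ _ (by linarith)] at h2
    linarith
  have hg3 : ∀ n, g n ≤ ⌈L / (ε / 2)⌉₊ := fun n =>
    Nat.ceil_mono (div_le_div_of_nonneg_right (a n).2.2.le (by linarith))
  obtain ⟨c, hc⟩ : ∃ c, ∃ᶠ n in atTop, g n = c := by
    by_contra! hne
    have : ∀ᶠ n in atTop, ∀ c ∈ Finset.range (⌈L / (ε / 2)⌉₊ + 1), g n ≠ c :=
      (Filter.eventually_all_finset _).2 fun c _ => hne c
    obtain ⟨n, hn⟩ := this.exists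
    exact hn (g n) (Finset.mem_range.2 (Nat.lt_succ_of_le (hg3 n))) rfl
  obtain ⟨n₁, hn₁⟩ := hc.exists
  have hu0 : 0 ≤ (c : ℝ) * (ε / 2) := by positivity
  have hvL : (c : ℝ) * (ε / 2) + ε / 2 < L := by
    have := hg2 n₁
    have := hlen n₁
    have := (b n₁).2.2
    rw [hn₁] at *
    linarith
  let u : Set.Ico 0 L := ⟨c * (ε / 2), hu0, by linarith⟩
  let v : Set.Ico 0 L := ⟨c * (ε / 2) + ε / 2, by linarith, hvL⟩
  have huv : ∀ n, SameItinerary D T n u v := by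
    intro n
    obtain ⟨m, hm, hgm⟩ := (frequently_atTop.1 hc) n
    have h1 := hg1 m
    have h2 := hg2 m
    have h3 := hlen m
    rw [hgm] at h1 h2
    have hau : a m ≤ u := h1
    have huv : u ≤ v := by change (c : ℝ) * (ε / 2) ≤ c * (ε / 2) + ε / 2; linarith
    have hvb : v ≤ b m := by change (c : ℝ) * (ε / 2) + ε / 2 ≤ b m; linarith
    exact (((hab m).of_mem_Icc hT hau (huv.trans hvb)).symm.trans
      ((hab m).of_mem_Icc hT (hau.trans huv) hvb)).mono hm
  -- two points of the orbit of `u` are at distance less than `ε / 2`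
  have hshift : ∀ m m', m ≠ m' → (T^[m] u : ℝ) ≤ T^[m'] u → (T^[m'] u : ℝ) < T^[m] u + ε / 2 →
      False := by
    intro m m' hmm h1 h2
    have hcl : ∀ n, SameItinerary D T n (T^[m] u) (T^[m'] u) := by
      intro n
      have h3 := (huv (n + m)).iterate
      refine h3.of_mem_Icc hT h1 ?_
      have h4 := (huv m).iterate_sub hT
      have h5 : (v : ℝ) - u = ε / 2 := by change (c : ℝ) * (ε / 2) + ε / 2 - c * (ε / 2) = _; ring
      change (T^[m'] u : ℝ) ≤ T^[m] v
      linarith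
    rcases lt_or_gt_of_ne hmm with h | h
    · refine not_forall_sameItinerary_iterate hT hmin (Nat.sub_pos_of_lt h) (T^[m] u) ?_
      rwa [← Function.iterate_add_apply, Nat.sub_add_cancel h.le]
    · refine not_forall_sameItinerary_iterate hT hmin (Nat.sub_pos_of_lt h) (T^[m'] u) ?_
      rw [← Function.iterate_add_apply, Nat.sub_add_cancel h.le]
      exact fun n => (hcl n).symm
  let w : ℕ → ℕ := fun m => ⌊(T^[m] u : ℝ) / (ε / 2)⌋₊
  obtain ⟨m, -, m', -, hmm, hw⟩ := Finset.exists_ne_map_eq_of_card_lt_of_maps_to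
      (s := Finset.range (⌊L / (ε / 2)⌋₊ + 2)) (t := Finset.range (⌊L / (ε / 2)⌋₊ + 1))
      (f := w) (by simp) (fun t _ => by
        have : w t ≤ ⌊L / (ε / 2)⌋₊ :=
          Nat.floor_mono (div_le_div_of_nonneg_right (T^[t] u).2.2.le (by linarith))
        simpa [Nat.lt_succ_iff] using this)
  have hlo : ∀ m, (w m : ℝ) * (ε / 2) ≤ T^[m] u := fun m => by
    rw [← le_div_iff₀ (by linarith)]
    exact Nat.floor_le (div_nonneg (T^[m] u).2.1 (by linarith))
  have hhi : ∀ m, (T^[m] u : ℝ) < (w m : ℝ) * (ε / 2) + ε / 2 := fun m => by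
    have := Nat.lt_floor_add_one ((T^[m] u : ℝ) / (ε / 2))
    rw [div_lt_iff₀ (by linarith)] at this
    change _ < ((w m : ℝ) + 1) * (ε / 2) at this
    linarith
  have h1 := hlo m
  have h2 := hhi m
  have h3 := hlo m'
  have h4 := hhi m'
  rw [hw] at h1 h2
  rcases le_total (T^[m] u : ℝ) (T^[m'] u) with h | h
  · exact hshift m m' hmm h (by linarith)
  · exact hshift m' m hmm.symm h (by linarith)

end Itinerary

/-! ### Invariance of length and Poincaré recurrence -/

section Recurrence

variable {L : ℝ} {D : Finset ℝ} {T : Set.Ico 0 L → Set.Ico 0 L}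

theorem ordConnected_setOf_cutCode_eq (D c : Finset ℝ) :
    Set.OrdConnected {x : ℝ | cutCode D x = c} := by
  refine ⟨fun x hx y hy z hz => ?_⟩
  have hxy : cutCode D x = cutCode D y := Eq.trans hx (Eq.symm hy)
  rw [cutCode_eq_iff] at hxy
  refine Eq.trans ?_ hx
  exact cutCode_eq_iff.2 fun d hd =>
    ⟨fun h => (hxy d hd).2 (h.trans hz.2), fun h => h.trans hz.1⟩

/-- An injective piecewise translation preserves Lebesgue measure. -/
theorem IsPiecewiseTranslation.volume_image (hT : IsPiecewiseTranslation D T)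
    {A : Set (Set.Ico 0 L)} (hA : MeasurableSet (Subtype.val '' A)) :
    MeasurableSet (Subtype.val '' (T '' A)) ∧
      volume (Subtype.val '' (T '' A)) = volume (Subtype.val '' A) := by
  let P : Finset ℝ → Set (Set.Ico 0 L) := fun c => {x | x ∈ A ∧ cutCode D x = c}
  have hAP : A = ⋃ c ∈ D.powerset, P c := by
    ext x
    simp [P, cutCode]
  have hPm : ∀ c, MeasurableSet (Subtype.val '' P c) := by
    intro c
    have : Subtype.val '' P c = Subtype.val '' A ∩ {x : ℝ | cutCode D x = c} := by
      ext x
      simp only [P, Set.mem_image, Set.mem_ofPred_eq, Set.mem_inter_iff]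
      constructor
      · rintro ⟨y, ⟨hy, hc⟩, rfl⟩
        exact ⟨⟨y, hy, rfl⟩, hc⟩
      · rintro ⟨⟨y, hy, rfl⟩, hc⟩
        exact ⟨y, ⟨hy, hc⟩, rfl⟩
    rw [this]
    exact hA.inter (ordConnected_setOf_cutCode_eq D c).measurableSet
  have hTP : ∀ c, MeasurableSet (Subtype.val '' (T '' P c)) ∧
      volume (Subtype.val '' (T '' P c)) = volume (Subtype.val '' P c) := by
    intro c
    rcases (P c).eq_empty_or_nonempty with he | ⟨a, ha⟩
    · simp [he]
    · have : Subtype.val '' (T '' P c) =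
          (fun x : ℝ => x + ((T a : ℝ) - a)) '' (Subtype.val '' P c) := by
        rw [Set.image_image, Set.image_image]
        refine Set.image_congr fun x hx => ?_
        have := hT.sub_eq a x (ha.2.trans hx.2.symm)
        linarith
      rw [this, Set.image_add_right]
      exact ⟨measurable_add_const _ (hPm c), measure_preimage_add_right _ _ _⟩
  have hdis : Set.PairwiseDisjoint (D.powerset : Set (Finset ℝ)) P := by
    intro c _ c' _ hcc
    refine Set.disjoint_left.2 fun x hx hx' => hcc ?_
    exact hx.2.symm.trans hx'.2
  have hdis1 : Set.PairwiseDisjoint (D.powerset : Set (Finset ℝ))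
      fun c => Subtype.val '' P c := fun c hc c' hc' hcc =>
    (Set.disjoint_image_iff Subtype.val_injective).2 (hdis hc hc' hcc)
  have hdis2 : Set.PairwiseDisjoint (D.powerset : Set (Finset ℝ))
      fun c => Subtype.val '' (T '' P c) := fun c hc c' hc' hcc =>
    (Set.disjoint_image_iff Subtype.val_injective).2
      ((Set.disjoint_image_iff hT.injective).2 (hdis hc hc' hcc))
  have hA' : Subtype.val '' A = ⋃ c ∈ D.powerset, Subtype.val '' P c := by
    conv_lhs => rw [hAP]
    simp only [Set.image_iUnion]
  have hTA : Subtype.val '' (T '' A) = ⋃ c ∈ D.powerset, Subtype.val '' (T '' P c) := by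
    conv_lhs => rw [hAP]
    simp only [Set.image_iUnion]
  rw [hTA, hA', measure_biUnion_finset hdis1 fun c _ => hPm c,
    measure_biUnion_finset hdis2 fun c _ => (hTP c).1]
  exact ⟨Finset.measurableSet_biUnion _ fun c _ => (hTP c).1,
    Finset.sum_congr rfl fun c _ => (hTP c).2⟩

theorem IsPiecewiseTranslation.volume_image_iterate (hT : IsPiecewiseTranslation D T)
    {A : Set (Set.Ico 0 L)} (hA : MeasurableSet (Subtype.val '' A)) (n : ℕ) :
    MeasurableSet (Subtype.val '' (T^[n] '' A)) ∧
      volume (Subtype.val '' (T^[n] '' A)) = volume (Subtype.val '' A) := by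
  induction n with
  | zero => simpa using hA
  | succ n ih =>
    rw [Function.iterate_succ', Set.image_comp]
    exact ⟨(hT.volume_image ih.1).1, (hT.volume_image ih.1).2.trans ih.2⟩

/-- Poincaré recurrence to an interval, for the powers of an injective piecewise translation. -/
theorem IsPiecewiseTranslation.exists_iterate_mem_Ico (hT : IsPiecewiseTranslation D T)
    {a b : ℝ} (ha : 0 ≤ a) (hab : a < b) (hb : b ≤ L) (q : ℕ) :
    ∃ y : Set.Ico 0 L, (y : ℝ) ∈ Set.Ico a b ∧
      ∃ p : ℕ, 0 < p ∧ (T^[q * p] y : ℝ) ∈ Set.Ico a b := by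
  let J : Set (Set.Ico 0 L) := {y | (y : ℝ) ∈ Set.Ico a b}
  have hJ : Subtype.val '' J = Set.Ico a b := by
    ext x
    simp only [J, Set.mem_image, Set.mem_ofPred_eq]
    exact ⟨fun ⟨y, hy, h⟩ => h ▸ hy,
      fun hx => ⟨⟨x, ha.trans hx.1, hx.2.trans_le hb⟩, hx, rfl⟩⟩
  have hJm : MeasurableSet (Subtype.val '' J) := hJ ▸ measurableSet_Ico
  have hvol := fun n => hT.volume_image_iterate hJm n
  have hJv : volume (Subtype.val '' J) = ENNReal.ofReal (b - a) := by
    rw [hJ, Real.volume_Ico]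
  obtain ⟨N, hN⟩ := exists_nat_gt (L / (b - a))
  rw [div_lt_iff₀ (by linarith)] at hN
  -- `N` images of length `b - a` cannot be disjoint in `[0, L)`.
  have hpig : volume (Set.Ico 0 L) <
      ∑ j ∈ Finset.range N, volume (Subtype.val '' (T^[q * j] '' J)) := by
    simp only [fun n => (hvol n).2, hJv, Finset.sum_const, Finset.card_range, nsmul_eq_mul]
    rw [Real.volume_Ico, ← ENNReal.ofReal_natCast, ← ENNReal.ofReal_mul (Nat.cast_nonneg N)]
    refine (ENNReal.ofReal_lt_ofReal_iff_of_nonneg (by linarith)).2 (by linarith)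
  obtain ⟨i, -, j, -, hij, x, hxi, hxj⟩ := exists_nonempty_inter_of_measure_univ_lt_sum_measure
    (volume.restrict (Set.Ico 0 L)) (s := Finset.range N)
    (t := fun j => Subtype.val '' (T^[q * j] '' J))
    (fun j _ => (hvol (q * j)).1.nullMeasurableSet) (by
      rw [Measure.restrict_apply_univ]
      refine hpig.trans_le (Finset.sum_le_sum fun j _ => ?_)
      rw [Measure.restrict_apply (hvol _).1, Set.inter_eq_left.2]
      rintro _ ⟨y, -, rfl⟩
      exact y.2)
  obtain ⟨-, ⟨y, hy, rfl⟩, rfl⟩ := hxi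
  obtain ⟨-, ⟨z, hz, rfl⟩, hzy⟩ := hxj
  have hzy : T^[q * j] z = T^[q * i] y := Subtype.ext hzy
  have key : ∀ i j, i < j → ∀ y z : Set.Ico 0 L, y ∈ J → z ∈ J → T^[q * j] z = T^[q * i] y →
      ∃ y : Set.Ico 0 L, (y : ℝ) ∈ Set.Ico a b ∧
        ∃ p : ℕ, 0 < p ∧ (T^[q * p] y : ℝ) ∈ Set.Ico a b := by
    intro i j hij y z hy hz h
    refine ⟨z, hz, j - i, Nat.sub_pos_of_lt hij, ?_⟩
    have : T^[q * (j - i)] z = y := by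
      apply hT.injective.iterate (q * i)
      rw [← Function.iterate_add_apply, ← Nat.mul_add, Nat.add_sub_cancel' hij.le, h]
    rw [this]
    exact hy
  rcases lt_or_gt_of_ne hij with h | h
  · exact key i j h y z hy hz hzy
  · exact key j i h z y hz hy hzy.symm

/-- A cylinder contains a right neighbourhood of each of its points. -/
theorem exists_forall_sameItinerary_of_lt (hT : IsPiecewiseTranslation D T) (n : ℕ)
    (x : Set.Ico 0 L) :
    ∃ b : ℝ, (x : ℝ) < b ∧ b ≤ L ∧
      ∀ y : Set.Ico 0 L, x ≤ y → (y : ℝ) < b → SameItinerary D T n x y := by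
  induction n with
  | zero => exact ⟨L, x.2.2, le_rfl, fun y _ _ s hs => absurd hs (Nat.not_lt_zero s)⟩
  | succ n ih =>
    obtain ⟨b, hxb, hbL, hb⟩ := ih
    obtain ⟨e, he, hD⟩ : ∃ e > 0, ∀ d ∈ D, (T^[n] x : ℝ) < d → (T^[n] x : ℝ) + e ≤ d := by
      have : ∀ᶠ e in 𝓝[>] (0 : ℝ), ∀ d ∈ D, (T^[n] x : ℝ) < d → (T^[n] x : ℝ) + e ≤ d := by
        refine (Filter.eventually_all_finset D).2 fun d _ => ?_
        by_cases hd : (T^[n] x : ℝ) < d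
        · filter_upwards [Ioo_mem_nhdsGT (sub_pos.2 hd)] with e he _
          linarith [he.2]
        · exact Eventually.of_forall fun e h => absurd h hd
      obtain ⟨e, he, he'⟩ := (this.and self_mem_nhdsWithin).exists
      exact ⟨e, he', he⟩
    refine ⟨min b (x + e), lt_min hxb (by linarith), (min_le_left _ _).trans hbL,
      fun y hxy hy => ?_⟩
    have h1 := hb y hxy (hy.trans_le (min_le_left _ _))
    have h2 := h1.iterate_sub hT
    have h3 := hy.trans_le (min_le_right _ _)
    have h4 : (x : ℝ) ≤ y := hxy
    refine SameItinerary.succ_iff.2 ⟨h1, cutCode_eq_iff.2 fun d hd => ⟨fun h => by linarith,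
      fun h => ?_⟩⟩
    by_contra! hlt
    linarith [hD d hd hlt]

/-- A forward invariant set cannot miss a cylinder: if a set is forward invariant, nonempty and a
union of cylinders of order `n`, then it meets every cylinder. -/
theorem exists_sameItinerary_mem (hT : IsPiecewiseTranslation D T)
    (hmin : OrbitsMeetIntervals T) {n : ℕ} {Z : Set (Set.Ico 0 L)} (hZ : Z.Nonempty)
    (hinv : ∀ z ∈ Z, T z ∈ Z) (hcyl : ∀ z ∈ Z, ∀ z', SameItinerary D T n z z' → z' ∈ Z)
    (x : Set.Ico 0 L) : ∃ z ∈ Z, SameItinerary D T n x z := by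
  have hinv' : ∀ m, ∀ z ∈ Z, T^[m] z ∈ Z := by
    intro m
    induction m with
    | zero => exact fun z hz => hz
    | succ m ih => exact fun z hz => ih _ (hinv z hz)
  obtain ⟨w, hw⟩ := hZ
  obtain ⟨b, hxb, hbL, hb⟩ := exists_forall_sameItinerary_of_lt hT n x
  obtain ⟨y, hxy, hyb, m, q, hmq⟩ := hmin w x b x.2.1 hxb hbL
  have hyZ : T^[q] y ∈ Z := hmq ▸ hinv' m w hw
  have hxy' := hb y (le_of_lt hxy) hyb
  obtain ⟨c, hyc, hcL, hc⟩ := exists_forall_sameItinerary_of_lt hT (n + q) y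
  -- Recurrence for the power `q + 1` makes the return time at least `q`: the orbit of `u` is in `Z`
  -- by time `q`, and is still there when it returns next to `y`, in the cylinder of `x`.
  obtain ⟨u, hu, p, hp, hup⟩ := hT.exists_iterate_mem_Ico y.2.1 hyc hcL (q + 1)
  refine ⟨T^[(q + 1) * p] u, ?_, ?_⟩
  · have h1 : T^[q] u ∈ Z := hcyl _ hyZ _ (hc u hu.1 hu.2).iterate
    have h2 : q ≤ (q + 1) * p := (Nat.le_succ q).trans (Nat.le_mul_of_pos_right _ hp)
    rw [← Nat.sub_add_cancel h2, Function.iterate_add_apply]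
    exact hinv' _ _ h1
  · exact hxy'.trans ((hc _ hup.1 hup.2).mono (Nat.le_add_right n q))

end Recurrence

/-! ### Different Birkhoff limits separate words -/

section Separation

/-- The constant absorbs the finitely many small `N`; a bound for all `N` is needed since windows
may start at any time. -/
theorem exists_abs_birkhoffSum_sub_le {X : Type*} {T : X → X} {f : X → ℝ} {x : X} {m : ℝ}
    (h : Tendsto (fun N : ℕ => birkhoffAverage ℝ T f N x) atTop (𝓝 m)) {ε : ℝ} (hε : 0 < ε) :
    ∃ K : ℝ, ∀ N : ℕ, |birkhoffSum T f N x - N * m| ≤ ε * N + K := by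
  obtain ⟨N₀, hN₀⟩ := Metric.tendsto_atTop.1 h ε hε
  refine ⟨∑ N ∈ Finset.range (N₀ + 1), |birkhoffSum T f N x - N * m|, fun N => ?_⟩
  have hK : 0 ≤ ∑ N ∈ Finset.range (N₀ + 1), |birkhoffSum T f N x - N * m| :=
    Finset.sum_nonneg fun _ _ => abs_nonneg _
  rcases le_or_gt N N₀ with hN | hN
  · have h1 := Finset.single_le_sum (f := fun N : ℕ => |birkhoffSum T f N x - N * m|)
      (fun _ _ => abs_nonneg _) (Finset.mem_range.2 (Nat.lt_succ_of_le hN))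
    have h2 : 0 ≤ ε * N := by positivity
    linarith
  · have h1 := hN₀ N hN.le
    have hNpos : (0 : ℝ) < N := by exact_mod_cast (Nat.zero_le _).trans_lt hN
    rw [Real.dist_eq, birkhoffAverage, smul_eq_mul] at h1
    have h2 : birkhoffSum T f N x - N * m = N * ((N : ℝ)⁻¹ * birkhoffSum T f N x - m) := by
      field_simp
    rw [h2, abs_mul, Nat.abs_cast]
    nlinarith

variable {L : ℝ} {D : Finset ℝ} {T : Set.Ico 0 L → Set.Ico 0 L}

/-- If a uniformly continuous function has distinct Birkhoff limits at `x` and `x'`, then windows of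
length `n` in the initial segments of length `A * n` of the two orbits have distinct
itineraries. -/
theorem eventually_not_sameItinerary (hT : IsPiecewiseTranslation D T)
    (hmin : OrbitsMeetIntervals T) {f : Set.Ico 0 L → ℝ} (hf : UniformContinuous f)
    {x x' : Set.Ico 0 L} {m m' : ℝ} (hm : m ≠ m')
    (hx : Tendsto (fun N : ℕ => birkhoffAverage ℝ T f N x) atTop (𝓝 m))
    (hx' : Tendsto (fun N : ℕ => birkhoffAverage ℝ T f N x') atTop (𝓝 m')) (A : ℕ) :
    ∀ᶠ n in atTop, ∀ t ≤ A * n, ∀ t' ≤ A * n, ¬ SameItinerary D T n (T^[t] x) (T^[t'] x') := by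
  set δ := |m - m'| with hδdef
  have hδ : 0 < δ := abs_pos.2 (sub_ne_zero.2 hm)
  -- A window `[t, t + n)` with `t ≤ A * n` is a difference of two initial sums, so its error is at
  -- most `ε * (2 * A + 1) * n = δ / 8 * n` plus a constant.
  set ε := δ / (8 * (2 * A + 1)) with hεdef
  have hA : (0 : ℝ) < 2 * A + 1 := by positivity
  have hε : 0 < ε := by positivity
  have hεA : ε * (2 * A + 1) = δ / 8 := by rw [hεdef]; field_simp
  obtain ⟨K, hK⟩ := exists_abs_birkhoffSum_sub_le hx hε
  obtain ⟨K', hK'⟩ := exists_abs_birkhoffSum_sub_le hx' hε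
  obtain ⟨η, hη, hfη⟩ := Metric.uniformContinuous_iff.1 hf (δ / 4) (by linarith)
  obtain ⟨n₁, hn₁⟩ := exists_forall_sameItinerary_abs_sub_lt hT hmin hη
  obtain ⟨n₂, hn₂⟩ := exists_nat_gt (2 * (2 * K + 2 * K') / δ)
  filter_upwards [eventually_ge_atTop n₁, eventually_ge_atTop n₂] with n h1 h2 t ht t' ht' hsame
  have hwin : ∀ (y : Set.Ico 0 L) (c C : ℝ) (t : ℕ), t ≤ A * n →
      (∀ N : ℕ, |birkhoffSum T f N y - N * c| ≤ ε * N + C) →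
      |birkhoffSum T f n (T^[t] y) - n * c| ≤ δ / 8 * n + 2 * C := by
    intro y c C t ht hC
    have e1 := hC (t + n)
    have e2 := hC t
    have e3 : (t : ℝ) ≤ A * n := by exact_mod_cast ht
    have e4 : ε * t ≤ ε * (A * n) := mul_le_mul_of_nonneg_left e3 hε.le
    have e5 : ε * (2 * A + 1) * n = δ / 8 * n := by rw [hεA]
    rw [birkhoffSum_add, Nat.cast_add] at e1
    rw [abs_le] at e1 e2 ⊢
    constructor <;> nlinarith
  have w1 := hwin x m K t ht hK
  have w2 := hwin x' m' K' t' ht' hK'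
  have w3 : |birkhoffSum T f n (T^[t] x) - birkhoffSum T f n (T^[t'] x')| ≤ n * (δ / 4) := by
    rw [birkhoffSum, birkhoffSum, ← Finset.sum_sub_distrib]
    refine (Finset.abs_sum_le_sum_abs _ _).trans ?_
    have : ∀ s ∈ Finset.range n,
        |f (T^[s] (T^[t] x)) - f (T^[s] (T^[t'] x'))| ≤ δ / 4 := by
      intro s hs
      have := hn₁ n h1 _ _ hsame
      have h3 := hsame.symm.iterate_sub_of_le hT (Finset.mem_range.1 hs).le
      have h4 : dist (T^[s] (T^[t] x)) (T^[s] (T^[t'] x')) < η := by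
        rw [Subtype.dist_eq, Real.dist_eq, h3]
        exact this
      exact (Real.dist_eq _ _ ▸ hfη h4).le
    simpa using Finset.sum_le_sum this
  have hn : 2 * (2 * K + 2 * K') < n * δ := by
    rw [div_lt_iff₀ hδ] at hn₂
    have : (n₂ : ℝ) * δ ≤ n * δ := mul_le_mul_of_nonneg_right (by exact_mod_cast h2) hδ.le
    linarith
  have hfin : n * δ ≤ n * (δ / 4) + (δ / 8 * n + 2 * K) + (δ / 8 * n + 2 * K') := by
    have : n * δ = |(n : ℝ) * m - n * m'| := by
      rw [← mul_sub, abs_mul, Nat.abs_cast]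
    rw [this]
    rw [abs_le] at w1 w2 w3 ⊢
    constructor <;> linarith
  linarith

end Separation

/-! ### From periods at every scale to one period -/

/-- A sequence which, for all large `n`, has a period of order `n` on a much longer segment of
length of order `n`, is eventually periodic. -/
theorem exists_eventually_periodic {α : Type*} {c : ℕ → α} {r n₀ : ℕ}
    (h : ∀ n ≥ n₀, ∃ l, 0 < l ∧ l ≤ r * n + 1 ∧
      ∀ v, r * n ≤ v → v + l ≤ (6 * r + 6) * n → c (v + l) = c v) :
    ∃ s p, 0 < p ∧ ∀ v ≥ s, c (v + p) = c v := by
  set n₁ := n₀ + 1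
  obtain ⟨p, hp, hpn, hper⟩ := h n₁ (Nat.le_succ _)
  refine ⟨r * n₁, p, hp, ?_⟩
  -- The first period `p` survives at all scales: the period `q` of the next scale serves only to
  -- shift `v` back into the range already treated.
  have key : ∀ n ≥ n₁, ∀ v, r * n₁ ≤ v → v + p ≤ (6 * r + 6) * n → c (v + p) = c v := by
    intro n hn
    induction n, hn using Nat.le_induction with
    | base => exact hper
    | succ n hn ih =>
      obtain ⟨q, hq, hqn, hqper⟩ := h (n + 1) (by omega)
      intro v
      induction v using Nat.strong_induction_on with
      | _ v ihv =>
        intro hv hvn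
        by_cases hle : v + p ≤ (6 * r + 6) * n
        · exact ih v hv hle
        · have e1 : r * n₁ ≤ r * n := Nat.mul_le_mul_left r hn
          have e2 : r * (n + 1) = r * n + r := by ring
          have e3 : (6 * r + 6) * n = 6 * (r * n) + 6 * n := by ring
          have e4 : (6 * r + 6) * (n + 1) = 6 * (r * n) + 6 * n + 6 * r + 6 := by ring
          have e5 : 1 ≤ n := by omega
          have e6 : r ≤ r * n := Nat.le_mul_of_pos_right r e5
          obtain ⟨w, rfl⟩ : ∃ w, v = w + q := ⟨v - q, by omega⟩
          have i1 : c (w + q) = c w := hqper w (by omega) (by omega)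
          have i2 : c (w + p + q) = c (w + p) := hqper (w + p) (by omega) (by omega)
          have i3 : c (w + p) = c w := ihv w (by omega) (by omega) (by omega)
          rw [i1, ← i3, ← i2]
          congr 1
          omega
  intro v hv
  refine key (n₁ + v + p) (by omega) v hv ?_
  calc v + p ≤ n₁ + v + p := by omega
    _ ≤ (6 * r + 6) * (n₁ + v + p) := Nat.le_mul_of_pos_left _ (by omega)

/-! ### Too many separated orbits are periodic -/

section Generic

variable {L : ℝ} {D : Finset ℝ} {T : Set.Ico 0 L → Set.Ico 0 L}

/-- Suppose that the itineraries of order `n` met by `r ≥ 2` orbits up to time `(7 * r + 7) * n` are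
pairwise disjoint, and that there are at most `r` cut points. Then each of the orbits is periodic
at scale `n`: there are only `r` right special itineraries, each orbit meets just one of them, and
always leaves it in the same way. -/
theorem exists_period_of_disjoint (hT : IsPiecewiseTranslation D T) (hmin : OrbitsMeetIntervals T)
    {r : ℕ} (hr : 2 ≤ r) (hD : D.card ≤ r) {x : Fin r → Set.Ico 0 L} {n : ℕ} (hn : 0 < n)
    (hsep : ∀ i i', i ≠ i' → ∀ t ≤ (7 * r + 7) * n, ∀ t' ≤ (7 * r + 7) * n,
      ¬ SameItinerary D T n (T^[t] (x i)) (T^[t'] (x i'))) (i : Fin r) :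
    ∃ l, 0 < l ∧ l ≤ r * n + 1 ∧ ∀ v, r * n ≤ v → v + l ≤ (6 * r + 6) * n →
      cutCode D (T^[v + l] (x i)) = cutCode D (T^[v] (x i)) := by
  have e7 : (7 * r + 7) * n = 7 * (r * n) + 7 * n := by ring
  have e6 : (6 * r + 6) * n = 6 * (r * n) + 6 * n := by ring
  have hgap : ∀ y, ∃ t ≤ r * n, IsRightSpecial D T n (T^[t] y) := fun y => by
    obtain ⟨t, ht, h⟩ := exists_isRightSpecial_iterate hT hmin hn y
    exact ⟨t, ht.trans (Nat.mul_le_mul_right n hD), h⟩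
  choose τ hτ hτs using fun i => hgap (x i)
  choose u huD hu using fun i => (hτs i).exists_cut hT
  have hττ : ∀ i i' y, SameItinerary D T n (T^[τ i] (x i)) y →
      SameItinerary D T n (T^[τ i'] (x i')) y → i = i' := by
    intro i i' y h h'
    by_contra hne
    have := hτ i
    have := hτ i'
    exact hsep i i' hne _ (by omega) _ (by omega) (h.trans h'.symm)
  have hinj : Function.Injective fun i => (T^[n] (u i) : ℝ) := by
    intro i i' h
    have h1 : u i = u i' := hT.injective.iterate n (Subtype.ext h)
    exact hττ i i' _ (hu i) (h1 ▸ hu i')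
  -- The `r` orbits give `r` distinct cut points, so by `hD` they exhaust `D`.
  have hsurj : ∀ v, (T^[n] v : ℝ) ∈ D → ∃ i, u i = v := by
    intro v hv
    have himg : Finset.univ.image (fun i => (T^[n] (u i) : ℝ)) = D := by
      refine Finset.eq_of_subset_of_card_le (fun d hd => ?_) ?_
      · obtain ⟨i, -, rfl⟩ := Finset.mem_image.1 hd
        exact huD i
      · rw [Finset.card_image_of_injective _ hinj]
        simpa using hD
    rw [← himg] at hv
    obtain ⟨i, -, hi⟩ := Finset.mem_image.1 hv
    exact ⟨i, hT.injective.iterate n (Subtype.ext hi)⟩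
  have hspec : ∀ i t, t ≤ (7 * r + 7) * n → IsRightSpecial D T n (T^[t] (x i)) →
      SameItinerary D T n (T^[τ i] (x i)) (T^[t] (x i)) := by
    intro i t ht hsp
    obtain ⟨v, hvD, hv⟩ := hsp.exists_cut hT
    obtain ⟨i', rfl⟩ := hsurj v hvD
    have h1 := (hu i').trans hv.symm
    by_cases hii : i' = i
    · exact hii ▸ h1
    · have := hτ i'
      exact absurd h1 (hsep i' i hii _ (by omega) _ ht)
  -- `u i` is the only point of its cylinder sent to a cut, so the side of `u i` decides the
  -- continuation.
  have hside_lt : ∀ i z z', SameItinerary D T n (T^[τ i] (x i)) z →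
      SameItinerary D T n (T^[τ i] (x i)) z' → (z < u i ↔ z' < u i) → z < z' →
      SameItinerary D T (n + 1) z z' := by
    intro i z z' hz hz' hzz hlt
    by_contra hnot
    obtain ⟨v, hzv, hvz, hvD, hv⟩ := (hz.symm.trans hz').exists_cut hT hnot hlt
    obtain ⟨i', rfl⟩ := hsurj v hvD
    obtain rfl := hττ i i' _ (hz.trans hv) (hu i')
    exact absurd (hzz.1 hzv) (not_lt.2 hvz)
  have hside : ∀ i z z', SameItinerary D T n (T^[τ i] (x i)) z →
      SameItinerary D T n (T^[τ i] (x i)) z' → (z < u i ↔ z' < u i) →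
      SameItinerary D T (n + 1) z z' := by
    intro i z z' hz hz' hzz
    rcases lt_trichotomy z z' with h | rfl | h
    · exact hside_lt i z z' hz hz' hzz h
    · exact SameItinerary.refl _ _
    · exact (hside_lt i z' z hz' hz hzz.symm h).symm
  have hone : ∀ t t', t ≤ (6 * r + 6) * n → t' ≤ (6 * r + 6) * n →
      IsRightSpecial D T n (T^[t] (x i)) → IsRightSpecial D T n (T^[t'] (x i)) →
      (T^[t] (x i) < u i ↔ T^[t'] (x i) < u i) := by
    intro t t' ht ht' hs hs'
    by_contra hdiff
    have : Nontrivial (Fin r) := Fin.nontrivial_iff_two_le.2 hr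
    obtain ⟨i', hi'⟩ := exists_ne i
    have hst := hspec i t (by omega) hs
    have hst' := hspec i t' (by omega) hs'
    -- Cylinders that orbit `i` visits at a time `a` no later than a special time `b`. The bound `b`
    -- keeps the walk `a`, `a + 1`, … within the horizon: at a special word it restarts from just
    -- after `t` or `t'`.
    let Z : Set (Set.Ico 0 L) := {z | ∃ a b, a ≤ b ∧ b ≤ (7 * r + 7) * n ∧
      IsRightSpecial D T n (T^[b] (x i)) ∧ SameItinerary D T n (T^[a] (x i)) z}
    have hback : ∀ s z, s ≤ (6 * r + 6) * n → SameItinerary D T (n + 1) (T^[s] (x i)) z →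
        T z ∈ Z := by
      intro s z hs hz
      obtain ⟨b, hb, hbs⟩ := hgap (T^[s + 1] (x i))
      rw [← Function.iterate_add_apply] at hbs
      refine ⟨s + 1, b + (s + 1), by omega, by omega, hbs, ?_⟩
      rw [Function.iterate_succ_apply']
      exact hz.iterate (q := 1)
    obtain ⟨z, ⟨a, b, hab, hb, -, hz⟩, hxz⟩ := exists_sameItinerary_mem hT hmin (n := n) (Z := Z)
      ⟨T^[t] (x i), t, t, le_rfl, by omega, hs, SameItinerary.refl _ _⟩
      (by
        rintro z ⟨a, b, hab, hb, hbs, hz⟩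
        by_cases hsp : IsRightSpecial D T n (T^[a] (x i))
        · have hz' := (hspec i a (hab.trans hb) hsp).trans hz
          -- The points at times `t` and `t'` lie on opposite sides of `u i`, so `z` continues like
          -- one of them.
          by_cases hzt : T^[t] (x i) < u i ↔ z < u i
          · exact hback t z ht (hside i _ _ hst hz' hzt)
          · exact hback t' z ht' (hside i _ _ hst' hz' (by tauto))
        · have hne : a ≠ b := fun h => hsp (h ▸ hbs)
          refine ⟨a + 1, b, by omega, hb, hbs, ?_⟩
          rw [Function.iterate_succ_apply']
          exact (hz.succ_of_not_isRightSpecial hsp).iterate (q := 1))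
      (by
        rintro z ⟨a, b, hab, hb, hbs, hz⟩ z' hzz'
        exact ⟨a, b, hab, hb, hbs, hz.trans hzz'⟩)
      (x i')
    exact hsep i i' hi'.symm a (hab.trans hb) 0 (Nat.zero_le _) (hz.trans hxz.symm)
  -- The next special visit is to the same cylinder, so `s + 1` is a return time; it becomes the
  -- period.
  obtain ⟨s, hs, hss⟩ := hgap (T^[τ i + 1] (x i))
  rw [← Function.iterate_add_apply] at hss
  have hτi := hτ i
  refine ⟨s + 1, Nat.succ_pos s, by omega, ?_⟩
  have key : ∀ w, τ i + w + (s + 1) ≤ (6 * r + 6) * n →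
      SameItinerary D T n (T^[τ i + w] (x i)) (T^[τ i + w + (s + 1)] (x i)) := by
    intro w
    induction w with
    | zero =>
      intro hw
      have e : τ i + 0 + (s + 1) = s + (τ i + 1) := by omega
      rw [e]
      exact hspec i _ (by omega) hss
    | succ w ih =>
      intro hw
      have h1 := ih (by omega)
      have h2 : SameItinerary D T (n + 1) (T^[τ i + w] (x i)) (T^[τ i + w + (s + 1)] (x i)) := by
        by_cases hsp : IsRightSpecial D T n (T^[τ i + w] (x i))
        · have hsp' := hsp.of_sameItinerary h1
          exact hside i _ _ (hspec i _ (by omega) hsp) (hspec i _ (by omega) hsp')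
            (hone _ _ (by omega) (by omega) hsp hsp')
        · exact h1.succ_of_not_isRightSpecial hsp
      have h3 := h2.iterate (q := 1)
      rw [← Function.iterate_add_apply, ← Function.iterate_add_apply] at h3
      rwa [show 1 + (τ i + w) = τ i + (w + 1) by omega,
        show 1 + (τ i + w + (s + 1)) = τ i + (w + 1) + (s + 1) by omega] at h3
  intro v hv hvl
  obtain ⟨w, rfl⟩ := Nat.exists_eq_add_of_le (hτi.trans hv)
  exact (key w hvl 0 hn).symm

/-- A minimal piecewise translation with at most `r ≥ 2` cut points does not have `r` points whose
Birkhoff averages have pairwise distinct limits. -/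
theorem not_pairwise_separated (hT : IsPiecewiseTranslation D T) (hmin : OrbitsMeetIntervals T)
    {r : ℕ} (hr : 2 ≤ r) (hD : D.card ≤ r) (x : Fin r → Set.Ico 0 L) :
    ¬ ∀ i i', i ≠ i' → ∃ (f : Set.Ico 0 L → ℝ) (m m' : ℝ), UniformContinuous f ∧ m ≠ m' ∧
      Tendsto (fun N : ℕ => birkhoffAverage ℝ T f N (x i)) atTop (𝓝 m) ∧
      Tendsto (fun N : ℕ => birkhoffAverage ℝ T f N (x i')) atTop (𝓝 m') := by
  intro h
  have hsep : ∀ᶠ n in atTop, ∀ i i', i ≠ i' → ∀ t ≤ (7 * r + 7) * n, ∀ t' ≤ (7 * r + 7) * n,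
      ¬ SameItinerary D T n (T^[t] (x i)) (T^[t'] (x i')) := by
    refine eventually_all.2 fun i => eventually_all.2 fun i' => ?_
    by_cases hii : i = i'
    · exact Eventually.of_forall fun n hne => absurd hii hne
    · obtain ⟨f, m, m', hf, hm, hx, hx'⟩ := h i i' hii
      filter_upwards [eventually_not_sameItinerary hT hmin hf hm hx hx' (7 * r + 7)] with n hn _
      exact hn
  obtain ⟨n₀, hn₀⟩ := eventually_atTop.1 (hsep.and (eventually_gt_atTop 0))
  obtain ⟨s, p, hp, hper⟩ := exists_eventually_periodic
    (c := fun v => cutCode D (T^[v] (x ⟨0, by omega⟩))) (r := r) (n₀ := n₀) fun n hn =>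
      exists_period_of_disjoint hT hmin hr hD (hn₀ n hn).2 (hn₀ n hn).1 _
  exact not_forall_cutCode_iterate_add hT hmin hp _ s hper

end Generic

/-! ### Reduction of interval exchanges to the half-open interval -/

section IntervalExchange

variable {k : ℕ} {π : Equiv.Perm (Fin k)} {lam : Fin (k + 1) → ℝ}
  {T : Set.Icc (0 : ℝ) (lam (Fin.last k)) → Set.Icc (0 : ℝ) (lam (Fin.last k))}

namespace IsIntervalExchange

theorem length_pos (hT : IsIntervalExchange k π lam T) (i : Fin k) :
    0 < lam i.succ - lam i.castSucc :=
  sub_pos.2 (hT.lam_strictMono i.castSucc_lt_succ)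

theorem last_pos (hT : IsIntervalExchange k π lam T) (hk : 0 < k) : 0 < lam (Fin.last k) := by
  rw [← hT.lam_zero]
  exact hT.lam_strictMono (Fin.lt_def.2 hk)

theorem exists_mem_Ico (hT : IsIntervalExchange k π lam T) {x : ℝ} (h0 : 0 ≤ x)
    (hx : x < lam (Fin.last k)) : ∃ i : Fin k, x ∈ Set.Ico (lam i.castSucc) (lam i.succ) := by
  by_contra! hno
  have : ∀ j : Fin (k + 1), lam j ≤ x := by
    intro j
    induction j using Fin.induction with
    | zero => rwa [hT.lam_zero]
    | succ i ih =>
      by_contra! hlt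
      exact hno i ⟨ih, hlt⟩
  exact absurd (this _) (not_le.2 hx)

/-- Images of distinct exchanged intervals do not overlap, which yields injectivity. -/
theorem add_length_le_sum (hT : IsIntervalExchange k π lam T) {i i' : Fin k} (h : π i < π i') :
    (∑ j : Fin k with π j < π i, (lam j.succ - lam j.castSucc)) + (lam i.succ - lam i.castSucc) ≤
      ∑ j : Fin k with π j < π i', (lam j.succ - lam j.castSucc) := by
  classical
  have hi : i ∉ Finset.univ.filter fun j => π j < π i := by simp
  rw [add_comm, ← Finset.sum_insert (f := fun j => lam j.succ - lam j.castSucc) hi]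
  refine Finset.sum_le_sum_of_subset_of_nonneg (fun j hj => ?_) fun j _ _ => (hT.length_pos j).le
  rcases Finset.mem_insert.1 hj with rfl | hj
  · simpa using h
  · simp only [Finset.mem_filter, Finset.mem_univ, true_and] at hj ⊢
    exact hj.trans h

theorem add_length_le_last (hT : IsIntervalExchange k π lam T) (i : Fin k) :
    (∑ j : Fin k with π j < π i, (lam j.succ - lam j.castSucc)) + (lam i.succ - lam i.castSucc) ≤
      lam (Fin.last k) := by
  classical
  have hi : i ∉ Finset.univ.filter fun j => π j < π i := by simp
  have htot : ∑ j : Fin k, (lam j.succ - lam j.castSucc) = lam (Fin.last k) := by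
    rw [Finset.sum_sub_distrib]
    have h1 := Fin.sum_univ_succ lam
    have h2 := Fin.sum_univ_castSucc lam
    have h3 := hT.lam_zero
    linarith
  rw [add_comm, ← Finset.sum_insert (f := fun j => lam j.succ - lam j.castSucc) hi, ← htot]
  exact Finset.sum_le_sum_of_subset_of_nonneg (Finset.subset_univ _)
    fun j _ _ => (hT.length_pos j).le

theorem apply_lt (hT : IsIntervalExchange k π lam T)
    {x : Set.Icc (0 : ℝ) (lam (Fin.last k))} (hx : (x : ℝ) < lam (Fin.last k)) :
    (T x : ℝ) < lam (Fin.last k) := by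
  obtain ⟨i, hi⟩ := hT.exists_mem_Ico x.2.1 hx
  have h1 := hT.map_eq i x hi
  have h2 := hT.add_length_le_last i
  linarith [hi.2]

theorem apply_injOn (hT : IsIntervalExchange k π lam T)
    {x y : Set.Icc (0 : ℝ) (lam (Fin.last k))} (hx : (x : ℝ) < lam (Fin.last k))
    (hy : (y : ℝ) < lam (Fin.last k)) (h : T x = T y) : x = y := by
  obtain ⟨i, hi⟩ := hT.exists_mem_Ico x.2.1 hx
  obtain ⟨j, hj⟩ := hT.exists_mem_Ico y.2.1 hy
  have h1 := hT.map_eq i x hi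
  have h2 := hT.map_eq j y hj
  have h3 : (T x : ℝ) = T y := congrArg _ h
  rcases lt_trichotomy (π i) (π j) with hij | hij | hij
  · have := hT.add_length_le_sum hij
    linarith [hi.2, hj.1]
  · obtain rfl := π.injective hij
    exact Subtype.ext (by linarith)
  · have := hT.add_length_le_sum hij
    linarith [hj.2, hi.1]

/-- The restriction of an interval exchange to the half-open interval. -/
def restrict (hT : IsIntervalExchange k π lam T) (x : Set.Ico (0 : ℝ) (lam (Fin.last k))) :
    Set.Ico (0 : ℝ) (lam (Fin.last k)) :=
  ⟨T ⟨x, x.2.1, x.2.2.le⟩, (T _).2.1, hT.apply_lt x.2.2⟩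

theorem semiconj_restrict (hT : IsIntervalExchange k π lam T) :
    Function.Semiconj (Set.inclusion Set.Ico_subset_Icc_self) hT.restrict T :=
  fun _ => rfl

/-- The interior end points of the intervals. -/
noncomputable def cuts (k : ℕ) (lam : Fin (k + 1) → ℝ) : Finset ℝ :=
  (Finset.univ.filter fun i : Fin k => (i : ℕ) ≠ 0).image fun i => lam i.castSucc

theorem card_cuts_le (hk : 0 < k) : (cuts k lam).card ≤ k - 1 := by
  refine Finset.card_image_le.trans ?_
  have : (Finset.univ.filter fun i : Fin k => (i : ℕ) ≠ 0) = Finset.univ.erase ⟨0, hk⟩ := by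
    ext i
    simp [Fin.ext_iff]
  rw [this, Finset.card_erase_of_mem (Finset.mem_univ _), Finset.card_univ, Fintype.card_fin]

theorem mem_Ico_of_cutCode_eq (hT : IsIntervalExchange k π lam T) {i : Fin k} {x y : ℝ}
    (h0 : 0 ≤ y) (hy : y < lam (Fin.last k)) (hx : x ∈ Set.Ico (lam i.castSucc) (lam i.succ))
    (h : cutCode (cuts k lam) x = cutCode (cuts k lam) y) :
    y ∈ Set.Ico (lam i.castSucc) (lam i.succ) := by
  rw [cutCode_eq_iff] at h
  constructor
  · by_cases hi : (i : ℕ) = 0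
    · have : i.castSucc = 0 := Fin.ext hi
      rwa [this, hT.lam_zero]
    · exact (h _ (Finset.mem_image.2 ⟨i, by simpa using hi, rfl⟩)).1 hx.1
  · by_cases hi : (i : ℕ) + 1 = k
    · have : i.succ = Fin.last k := Fin.ext hi
      rwa [this]
    · have hlt : (i : ℕ) + 1 < k := by omega
      have he : i.succ = (⟨i + 1, hlt⟩ : Fin k).castSucc := rfl
      by_contra! hle
      have := (h (lam i.succ) (Finset.mem_image.2 ⟨⟨i + 1, hlt⟩, by simp, he ▸ rfl⟩)).2 hle
      exact absurd this (not_le.2 hx.2)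

theorem isPiecewiseTranslation_restrict (hT : IsIntervalExchange k π lam T) :
    IsPiecewiseTranslation (cuts k lam) hT.restrict where
  injective x y h := by
    have hTxy : (hT.restrict x : ℝ) = hT.restrict y := by rw [h]
    have hxy := hT.apply_injOn (x := ⟨x, x.2.1, x.2.2.le⟩) (y := ⟨y, y.2.1, y.2.2.le⟩)
      x.2.2 y.2.2 (Subtype.ext hTxy)
    exact Set.inclusion_injective Set.Ico_subset_Icc_self hxy
  sub_eq x y h := by
    obtain ⟨i, hi⟩ := hT.exists_mem_Ico x.2.1 x.2.2
    have hj := hT.mem_Ico_of_cutCode_eq y.2.1 y.2.2 hi h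
    have h1 := hT.map_eq i ⟨x, x.2.1, x.2.2.le⟩ hi
    have h2 := hT.map_eq i ⟨y, y.2.1, y.2.2.le⟩ hj
    change (T ⟨y, y.2.1, y.2.2.le⟩ : ℝ) - T ⟨x, x.2.1, x.2.2.le⟩ = y - x
    rw [h1, h2]
    ring

theorem orbitsMeetIntervals_restrict (hT : IsIntervalExchange k π lam T) (hmin : IsMinimalMap T) :
    OrbitsMeetIntervals hT.restrict := by
  intro x a b ha hab hb
  have hopen : IsOpen {z : Set.Icc (0 : ℝ) (lam (Fin.last k)) | (z : ℝ) ∈ Set.Ioo a b} :=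
    isOpen_Ioo.preimage continuous_subtype_val
  obtain ⟨z, ⟨m, n, hmn⟩, hz⟩ := (hmin (Set.inclusion Set.Ico_subset_Icc_self x)).exists_mem_open
    hopen ⟨⟨(a + b) / 2, by linarith, by linarith⟩, by
      change a < (a + b) / 2 ∧ (a + b) / 2 < b; constructor <;> linarith⟩
  let y : Set.Ico (0 : ℝ) (lam (Fin.last k)) := ⟨z, z.2.1, hz.2.trans_le hb⟩
  refine ⟨y, hz.1, hz.2, m, n, Set.inclusion_injective Set.Ico_subset_Icc_self ?_⟩
  rw [hT.semiconj_restrict.iterate_right m x, hT.semiconj_restrict.iterate_right n y]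
  exact hmn

/-- Otherwise the right end point is fixed; since `[0, lam k)` is forward invariant, its full orbit
would be that point alone, hence not dense. -/
theorem apply_last_lt (hT : IsIntervalExchange k π lam T) (hmin : IsMinimalMap T) (hk : 0 < k)
    {x : Set.Icc (0 : ℝ) (lam (Fin.last k))} (hx : (x : ℝ) = lam (Fin.last k)) :
    (T x : ℝ) < lam (Fin.last k) := by
  refine lt_of_le_of_ne (T x).2.2 fun hfix => ?_
  have hTx : T x = x := Subtype.ext (hfix.trans hx.symm)
  have hpos := hT.last_pos hk
  have hopen : IsOpen {z : Set.Icc (0 : ℝ) (lam (Fin.last k)) | (z : ℝ) < lam (Fin.last k)} :=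
    isOpen_Iio.preimage continuous_subtype_val
  obtain ⟨z, ⟨m, n, hmn⟩, hz⟩ := (hmin x).exists_mem_open hopen ⟨⟨0, le_rfl, hpos.le⟩, hpos⟩
  have hiter : ∀ n, (T^[n] z : ℝ) < lam (Fin.last k) := by
    intro n
    induction n with
    | zero => exact hz
    | succ n ih => rw [Function.iterate_succ_apply']; exact hT.apply_lt ih
  have := hiter n
  rw [← hmn, Function.iterate_fixed hTx, hx] at this
  exact lt_irrefl _ this

/-- Every generic measure has a generic point in the half-open interval. -/
theorem exists_tendsto_birkhoffAverage_restrict (hT : IsIntervalExchange k π lam T)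
    (hmin : IsMinimalMap T) (hk : 0 < k) {μ : Measure (Set.Icc (0 : ℝ) (lam (Fin.last k)))}
    (hμ : IsGenericMeasure T μ) :
    ∃ x : Set.Ico (0 : ℝ) (lam (Fin.last k)), ∀ f : C(Set.Icc (0 : ℝ) (lam (Fin.last k)), ℝ),
      Tendsto (fun N : ℕ => birkhoffAverage ℝ hT.restrict
        (f ∘ Set.inclusion Set.Ico_subset_Icc_self) N x) atTop (𝓝 (∫ y, f y ∂μ)) := by
  obtain ⟨x, hx⟩ := hμ.exists_genericPoint
  obtain ⟨x', hx'lt, hx'⟩ : ∃ x' : Set.Icc (0 : ℝ) (lam (Fin.last k)),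
      (x' : ℝ) < lam (Fin.last k) ∧ IsGenericPointFor T μ x' := by
    rcases x.2.2.lt_or_eq with hlt | heq
    · exact ⟨x, hlt, hx⟩
    -- Shifting the starting point by one step does not change Birkhoff limits of a bounded
    -- function.
    · refine ⟨T x, hT.apply_last_lt hmin hk heq, fun f => ?_⟩
      have h1 := tendsto_birkhoffAverage_apply_sub_birkhoffAverage' (f := T) ℝ
        (isCompact_range f.continuous).isBounded x
      simpa using h1.add (hx f)
  let y : Set.Ico (0 : ℝ) (lam (Fin.last k)) := ⟨x', x'.2.1, hx'lt⟩
  refine ⟨y, fun f => ?_⟩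
  refine (hx' f).congr fun N => ?_
  refine congrArg ((N : ℝ)⁻¹ • ·) (Finset.sum_congr rfl fun n _ => congrArg f ?_)
  exact (hT.semiconj_restrict.iterate_right n y).symm

end IsIntervalExchange

end IntervalExchange

/-! ### Conclusion -/

theorem exists_integral_ne {X : Type*} [TopologicalSpace X] [CompactSpace X] [MeasurableSpace X]
    [HasOuterApproxClosed X] [BorelSpace X] {μ ν : Measure X} [IsFiniteMeasure μ]
    [IsFiniteMeasure ν] (h : μ ≠ ν) : ∃ f : C(X, ℝ), ∫ x, f x ∂μ ≠ ∫ x, f x ∂ν := by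
  by_contra! hf
  exact h (ext_of_forall_integral_eq_of_IsFiniteMeasure fun f => hf f.toContinuousMap)

theorem theorem1p4 (k : ℕ) (hk : 2 < k) (π : Equiv.Perm (Fin k)) (lam : Fin (k + 1) → ℝ)
    (T : Set.Icc (0 : ℝ) (lam (Fin.last k)) → Set.Icc (0 : ℝ) (lam (Fin.last k)))
    (hT : IsIntervalExchange k π lam T) (hmin : IsMinimalMap T) :
    {μ : Measure (Set.Icc (0 : ℝ) (lam (Fin.last k))) | IsGenericMeasure T μ}.encard
      ≤ ((k - 2 : ℕ) : ℕ∞) := by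
  by_contra! hlt
  have hle : ((k - 1 : ℕ) : ℕ∞) ≤
      {μ : Measure (Set.Icc (0 : ℝ) (lam (Fin.last k))) | IsGenericMeasure T μ}.encard := by
    have h1 := Order.add_one_le_of_lt hlt
    have h2 : k - 1 = (k - 2) + 1 := by omega
    rw [h2]
    exact_mod_cast h1
  obtain ⟨S, hS, hcard⟩ := Set.exists_subset_encard_eq hle
  have hSfin : S.Finite := Set.finite_of_encard_eq_coe hcard
  have := hSfin.fintype
  have hSc : Fintype.card S = k - 1 := by
    rw [Set.encard_eq_coe_toFinset_card, Set.toFinset_card] at hcard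
    exact_mod_cast hcard
  let e : Fin (k - 1) ≃ S := (Fintype.equivFinOfCardEq hSc).symm
  have hgen : ∀ i, IsGenericMeasure T (e i : Measure (Set.Icc (0 : ℝ) (lam (Fin.last k)))) :=
    fun i => hS (e i).2
  choose x hx using fun i => hT.exists_tendsto_birkhoffAverage_restrict hmin (by omega) (hgen i)
  -- Here `2 < k` enters as `2 ≤ k - 1`: a second orbit is needed for the contradiction.
  refine not_pairwise_separated hT.isPiecewiseTranslation_restrict
    (hT.orbitsMeetIntervals_restrict hmin) (by omega : 2 ≤ k - 1)
    (IsIntervalExchange.card_cuts_le (by omega)) x fun i i' hii => ?_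
  have := (hgen i).isProbabilityMeasure
  have := (hgen i').isProbabilityMeasure
  have hne : (e i).1 ≠ (e i').1 := fun h => hii (e.injective (Subtype.ext h))
  obtain ⟨f, hf⟩ := exists_integral_ne hne
  refine ⟨_, _, _, ?_, hf, hx i f, hx i' f⟩
  exact (CompactSpace.uniformContinuous_of_continuous f.continuous).comp
    (uniformContinuous_subtype_val.subtype_mk _)
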